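/- An effect algebra is a set $E$ with elements $0\neq 1$ and a partial operation $\oplus$ such that $\oplus$ is commutative and associative (if one side of either identity is defined, so is the other, and they agree), for every $a$ there is a unique $a'$ with $a\oplus a'=1$, and $1\oplus a$ is defined only for $a=0$. It is ordered by $a\le b$ iff $a\oplus c=b$ for some $c$ (then $c=b\ominus a$), and is called a lattice effect algebra if this order is a lattice. In a lattice effect algebra, $x,y$ are compatible if $x\oplus(y\ominus(x\wedge y))$ is defined and equals $x\vee y$. An MV-effect algebra is a lattice effect algebra in which any two elements are compatible. A block is a maximal set of pairwise compatible elements, and $E$ is block-finite if it has only finitely many blocks. $E$ is Archimedean if for each $x\ne 0$ there is a largest $n=\operatorname{ord}(x)$ for which $nx=x\oplus\dots\oplus x$ ($n$ times) exists. $E$ is atomic if every nonzero element lies above an atom, and complete if its order is a complete lattice. The interval topology $\tau_i$ is the topology having the intervals $[a,b]$, $a\le b$, as a closed subbasis. A net $(x_\alpha)$ order converges to $x$, written $x_\alpha\xrightarrow{(o)}x$, if there are nets $(u_\alpha)$, $(v_\alpha)$ over the same directed set with $u_\alpha\le x_\alpha\le v_\alpha$ for all $\alpha$, $(u_\alpha)$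 increasing with $\bigvee_\alpha u_\alpha=x$, and $(v_\alpha)$ decreasing with $\bigwedge_\alpha v_\alpha=x$. The order topology $\tau_o$ is the finest topology in which every order convergent net converges to its order limit. For an Archimedean atomic lattice effect algebra let $\mathcal U$ be the set of finite joins of elements $la$ with $a$ an atom and $1\le l\le\operatorname{ord}(a)$, and let $\mathcal V=\{v: v'\in\mathcal U\}$. Let $\Phi$ consist of the $\{0,1\}$-valued functions $f_u$ $(u\in\mathcal U)$ and $g_v$ $(v\in\mathcal V)$ given by $f_u(x)=1$ iff $u\le x$, and $g_v(x)=1$ iff $x\le v$. The topology $\tau_\Phi$ is that of the uniformity induced by the pseudometrics $(x,y)\mapsto|\varphi(x)-\varphi(y)|$, $\varphi\in\Phi$. **Theorem.** (i) On every Archimedean atomic MV-effect algebra $M$ the interval topology $\tau_i$ is Hausdorff and $\tau_i=\tau_o=\tau_\Phi$. (ii) Let $M$ be a complete atomic MV-effect algebra. For every net $(x_\alpha)$ in $M$ and every $x\in M$, $x_\alpha\to x$ in $\tau_o$ if and only if $x_\alpha\xrightarrow{(o)}x$. Moreover, $\tau_o$ is a compact Hausdorff topology and is induced by a uniformity on $M$.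 (iii) An atomic block-finite lattice effect algebra $E$ is complete if and only if $\tau_i=\tau_o$ and this topology is compact and Hausdorff. -/

import Mathlib

universe u v

/-- An effect algebra `(E; ⊕, 0, 1)`.  The partial operation is `oplus`, with `oplus a b = none`
meaning that `a ⊕ b` is not defined.  The equation of options in `oplus_assoc` says that if one of
`(a ⊕ b) ⊕ c`, `a ⊕ (b ⊕ c)` is defined then so is the other and they are equal. -/
class EffectAlgebra (E : Type u) extends Zero E, One E where
  oplus : E → E → Option E
  zero_ne_one' : (0 : E) ≠ 1
  oplus_comm : ∀ a b : E, oplus a b = oplus b a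
  oplus_assoc : ∀ a b c : E,
    (oplus a b).bind (fun d => oplus d c) = (oplus b c).bind (fun d => oplus a d)
  existsUnique_compl : ∀ a : E, ∃! b : E, oplus a b = some 1
  eq_zero_of_one_oplus : ∀ a : E, (oplus 1 a).isSome → a = 0

/-- A lattice effect algebra: an effect algebra that is a lattice in its induced order
`a ≤ b ↔ ∃ c, a ⊕ c = b`. -/
class LatticeEffectAlgebra (E : Type u) extends EffectAlgebra E, Lattice E where
  le_iff_exists_oplus : ∀ a b : E, a ≤ b ↔ ∃ c : E, oplus a c = some b

namespace EffectAlgebra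

theorem one_oplus_zero {E : Type u} [EffectAlgebra E] : oplus (1 : E) 0 = some 1 := by
  obtain ⟨b, hb, -⟩ := existsUnique_compl (1 : E)
  have hb' : oplus (1 : E) b = some 1 := hb
  have h0 : b = 0 := eq_zero_of_one_oplus b (by rw [hb']; rfl)
  rw [← h0]
  exact hb'

theorem oplus_zero {E : Type u} [EffectAlgebra E] (a : E) : oplus a 0 = some a := by
  obtain ⟨b, hb, -⟩ := existsUnique_compl a
  have hb' : oplus b a = some 1 := by rw [oplus_comm]; exact hb
  have h := oplus_assoc b a 0
  rw [hb'] at h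
  have h1 : some (1 : E) = (oplus a 0).bind (fun d => oplus b d) := one_oplus_zero.symm.trans h
  cases hd : oplus a 0 with
  | none => rw [hd] at h1; simp at h1
  | some d =>
    rw [hd] at h1
    have h2 : oplus b d = some 1 := h1.symm
    rw [(existsUnique_compl b).unique h2 hb']

/-- The multiple `n x = x ⊕ ⋯ ⊕ x` (`n` times), `none` if it does not exist. -/
def multiple {E : Type u} [EffectAlgebra E] : ℕ → E → Option E
  | 0, _ => some 0
  | n + 1, x => (multiple n x).bind (fun y => oplus y x)

/-- The isotropic index of `x`: the greatest `n` such that `n x` exists, or `⊤` if all exist. -/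
noncomputable def ord {E : Type u} [EffectAlgebra E] (x : E) : ℕ∞ :=
  ⨆ n : {n : ℕ // (multiple n x).isSome}, (n.1 : ℕ∞)

/-- Every nonzero element has finite isotropic index. -/
def IsArchimedean (E : Type u) [EffectAlgebra E] : Prop :=
  ∀ x : E, x ≠ 0 → ord x < ⊤

/-- `x'`, the unique element with `x ⊕ x' = 1`. -/
noncomputable def compl {E : Type u} [EffectAlgebra E] (x : E) : E :=
  (existsUnique_compl x).choose

end EffectAlgebra

namespace LatticeEffectAlgebra

open EffectAlgebra

instance instBoundedOrder {E : Type u} [LatticeEffectAlgebra E] : BoundedOrder E where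
  top := 1
  bot := 0
  le_top a := (le_iff_exists_oplus a 1).2 (existsUnique_compl a).exists
  bot_le a := (le_iff_exists_oplus 0 a).2 ⟨a, by rw [oplus_comm]; exact oplus_zero a⟩

/-- `x ↔ y`: with `c = y ⊖ (x ∧ y)`, `x ⊕ c` is defined and equals `x ∨ y`. -/
def Compatible {E : Type u} [LatticeEffectAlgebra E] (x y : E) : Prop :=
  ∃ c : E, oplus (x ⊓ y) c = some y ∧ oplus x c = some (x ⊔ y)

/-- An MV-effect algebra is a lattice effect algebra in which any two elements are compatible. -/
def IsMV (E : Type u) [LatticeEffectAlgebra E] : Prop :=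
  ∀ x y : E, Compatible x y

/-- Blocks are the maximal subsets of pairwise compatible elements. -/
def IsBlock {E : Type u} [LatticeEffectAlgebra E] (B : Set E) : Prop :=
  Maximal (fun S : Set E => ∀ x ∈ S, ∀ y ∈ S, Compatible x y) B

def IsBlockFinite (E : Type u) [LatticeEffectAlgebra E] : Prop :=
  {B : Set E | IsBlock B}.Finite

end LatticeEffectAlgebra

/-- Every subset has a supremum and an infimum. -/
def IsCompleteLat (L : Type u) [Lattice L] : Prop :=
  ∀ S : Set L, (∃ a : L, IsLUB S a) ∧ ∃ b : L, IsGLB S b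

/-- The interval topology `τ_i`: the closed intervals `[a, b]`, `a ≤ b`, form a closed subbasis. -/
def intervalTop (L : Type u) [Lattice L] : TopologicalSpace L :=
  TopologicalSpace.generateFrom {U : Set L | ∃ a b : L, a ≤ b ∧ U = (Set.Icc a b)ᶜ}

/-- Order convergence of the net `(x α)` to `a`: there are nets `p`, `q` over the same index set
with `p α ≤ x α ≤ q α`, `p` increasing with supremum `a` and `q` decreasing with infimum `a`. -/
def OrderConverges {L : Type u} [Lattice L] {J : Type v} [Preorder J] (x : J → L) (a : L) : Prop :=
  ∃ p q : J → L, (∀ j, p j ≤ x j ∧ x j ≤ q j) ∧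
    Monotone p ∧ IsLUB (Set.range p) a ∧ Antitone q ∧ IsGLB (Set.range q) a

/-- The order topology `τ_o`: the finest topology in which every order convergent net converges to
its order limit (`sInf` is the finest in Mathlib's order on topologies, and has this property).
Index sets from the universe of `L` suffice: for an order convergent net over a larger index set
one may pass to an index set of pairs `(p α, q α)`. -/
def orderTop (L : Type u) [Lattice L] : TopologicalSpace L :=
  sInf {t : TopologicalSpace L |
    ∀ (J : Type u) [Preorder J] [IsDirectedOrder J] [Nonempty J] (x : J → L) (a : L),
      OrderConverges x a → Filter.Tendsto x Filter.atTop (@nhds L t a)}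

namespace LatticeEffectAlgebra

open EffectAlgebra

/-- The set `𝒰` of finite joins of elements `l a`, where `a` is an atom and `1 ≤ l ≤ ord a`
(that is, `1 ≤ l` and `l a` exists). -/
def finJoins (E : Type u) [LatticeEffectAlgebra E] : Set E :=
  {x : E | ∃ S : Finset E,
    (∀ y ∈ S, ∃ (a : E) (l : ℕ), IsAtom a ∧ 1 ≤ l ∧ multiple l a = some y) ∧ x = S.sup id}

/-- The function family `Φ`: the `{0, 1}`-valued functions `f_u` (`f_u x = 1` iff `u ≤ x`) for
`u ∈ 𝒰`, and `g_v` (`g_v x = 1` iff `x ≤ v`) for `v' ∈ 𝒰`. -/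
noncomputable def Phi (E : Type u) [LatticeEffectAlgebra E] : Set (E → ℝ) :=
  {f : E → ℝ | ∃ w ∈ finJoins E, f = (Set.Ici w).indicator (fun _ => (1 : ℝ))} ∪
  {f : E → ℝ | ∃ w : E, compl w ∈ finJoins E ∧ f = (Set.Iic w).indicator (fun _ => (1 : ℝ))}

/-- The uniformity `𝒰_Φ` induced by the pseudometrics `(x, y) ↦ |φ x - φ y|`, `φ ∈ Φ`. -/
noncomputable def uniformityPhi (E : Type u) [LatticeEffectAlgebra E] : UniformSpace E :=
  ⨅ φ : Phi E, UniformSpace.comap φ.1 inferInstance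

/-- The topology `τ_Φ` of the uniformity `𝒰_Φ`. -/
noncomputable def tauPhi (E : Type u) [LatticeEffectAlgebra E] : TopologicalSpace E :=
  (uniformityPhi E).toTopologicalSpace

end LatticeEffectAlgebra

open EffectAlgebra LatticeEffectAlgebra

/-! With an absorbing element for undefined sums, `⊕` becomes a commutative monoid in which defined
sums cancel; order and compatibility are computed there.

Two facts about atoms carry the theorem. First, every `x` is the join of the members of `finJoins`
below it (`le_of_forall_finJoins_le`). Second, in a block, for an atom `a` with `n = ord a`, failing
to lie above `la` means lying below `((n + 1 - l)a)'` (`IsAtomIn.exists_not_le_iff`). In the MV case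
the second fact makes the sets defining `Phi` clopen for the interval topology, so `τ_i` is finer
than `τ_Φ`. The first, with `le_nhds_orderTop`, makes `τ_Φ` finer than `τ_o`, and `τ_o` is finer
than `τ_i` in every lattice. The cycle gives equality. Compactness of `τ_i` matches completeness of
the lattice.

In the block-finite case every ultrafilter contains a block. The bounds it has in that block squeeze
to one point, since otherwise an atom of the block could be added forever. That point is the only
possible interval limit and is a limit in `τ_o`. -/

namespace EffectAlgebra

/-- The elements of `E` together with an absorbing element standing for undefined sums. -/
def PartialSum (E : Type u) : Type u := Option E

/-! ### Partial sums as a total commutative monoid -/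

namespace PartialSum

variable {E : Type u} [EffectAlgebra E]

/-- An element of `E` as a defined sum. -/
def of (a : E) : PartialSum E := some a

omit [EffectAlgebra E] in
theorem of_injective : Function.Injective (of : E → PartialSum E) := fun _ _ h => Option.some.inj h

instance : Zero (PartialSum E) := ⟨of 0⟩

instance : Add (PartialSum E) :=
  ⟨fun A B => Option.bind A fun a => Option.bind B fun b => oplus a b⟩

theorem of_zero : of (0 : E) = 0 := rfl

theorem add_comm' (A B : PartialSum E) : A + B = B + A := by
  rcases A with _ | a <;> rcases B with _ | b
  · rfl
  · rfl
  · rfl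
  · exact oplus_comm a b

theorem add_assoc' (A B C : PartialSum E) : A + B + C = A + (B + C) := by
  rcases A with _ | a
  · rfl
  rcases B with _ | b
  · rfl
  rcases C with _ | c
  · change Option.bind (oplus a b) (fun _ => none) = none
    cases oplus a b <;> rfl
  · exact oplus_assoc a b c

theorem add_zero' (A : PartialSum E) : A + 0 = A := by
  rcases A with _ | a
  · rfl
  · exact oplus_zero a

instance : AddCommMonoid (PartialSum E) where
  add_assoc := add_assoc'
  add_comm := add_comm'
  add_zero := add_zero'
  zero_add A := by rw [add_comm', add_zero']
  nsmul := nsmulRec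

theorem exists_of_of_add_eq {A B : PartialSum E} {c : E} (h : A + B = of c) :
    ∃ a, A = of a := by
  rcases A with _ | a
  · cases h
  · exact ⟨a, rfl⟩

theorem exists_of_of_add_eq' {A B : PartialSum E} {c : E} (h : A + B = of c) :
    ∃ b, B = of b := by
  rw [add_comm] at h
  exact exists_of_of_add_eq h

theorem nsmul_of (n : ℕ) (a : E) : n • of a = multiple n a := by
  induction n with
  | zero => exact zero_nsmul _
  | succ n ih =>
    rw [succ_nsmul, ih]
    rfl

theorem of_add_compl (a : E) : of a + of (compl a) = of 1 :=
  (existsUnique_compl a).choose_spec.1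

theorem eq_compl {a : E} {B : PartialSum E} (h : of a + B = of 1) : B = of (compl a) := by
  obtain ⟨b, rfl⟩ := exists_of_of_add_eq' h
  exact congrArg of ((existsUnique_compl a).unique h (of_add_compl a))

theorem compl_compl (a : E) : compl (compl a) = a :=
  (of_injective (eq_compl (by rw [add_comm, of_add_compl]))).symm

/-- Adding `d'` completes both sums to `1`, where uniqueness of complements applies. Without a
defined total, cancellation fails. -/
theorem add_left_cancel_of {A B C : PartialSum E} {d : E} (hB : A + B = of d)
    (hC : A + C = of d) : B = C := by
  have h1 : (A + of (compl d)) + B = of 1 := by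
    rw [add_right_comm, hB, of_add_compl]
  have h2 : (A + of (compl d)) + C = of 1 := by
    rw [add_right_comm, hC, of_add_compl]
  obtain ⟨e, he⟩ := exists_of_of_add_eq h1
  rw [he] at h1 h2
  rw [eq_compl h1, eq_compl h2]

end PartialSum

end EffectAlgebra

/-! ### Order, orthogonality and compatibility -/

namespace LatticeEffectAlgebra

open PartialSum

variable {E : Type u} [LatticeEffectAlgebra E]

theorem le_iff {a b : E} : a ≤ b ↔ ∃ C, of a + C = of b := by
  rw [le_iff_exists_oplus]
  constructor
  · rintro ⟨c, hc⟩
    exact ⟨of c, hc⟩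
  · rintro ⟨C, hC⟩
    obtain ⟨c, rfl⟩ := exists_of_of_add_eq' hC
    exact ⟨c, hC⟩

theorem le_of_add_eq {a b : E} {C : PartialSum E} (h : of a + C = of b) : a ≤ b :=
  le_iff.2 ⟨C, h⟩

theorem le_of_add_eq' {a b : E} {C : PartialSum E} (h : C + of a = of b) : a ≤ b :=
  le_iff.2 ⟨C, by rwa [add_comm]⟩

theorem exists_add_eq {a b : E} (h : a ≤ b) : ∃ c, of a + of c = of b :=
  (le_iff_exists_oplus a b).1 h

theorem nonneg (a : E) : 0 ≤ a := bot_le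

theorem eq_zero_of_le_zero {a : E} (h : a ≤ 0) : a = 0 := le_antisymm h (nonneg a)

theorem exists_add_of_le {a b d : E} {C : PartialSum E} (hab : a ≤ b) (h : of b + C = of d) :
    ∃ e, of a + C = of e ∧ e ≤ d := by
  obtain ⟨Z, hZ⟩ := le_iff.1 hab
  have h1 : of a + C + Z = of d := by rw [add_right_comm, hZ, h]
  obtain ⟨e, he⟩ := exists_of_of_add_eq h1
  exact ⟨e, he, le_of_add_eq (he ▸ h1)⟩

theorem le_of_add_le_add_of {a b x y : E} {C : PartialSum E} (hx : of a + C = of x)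
    (hy : of b + C = of y) (hxy : x ≤ y) : a ≤ b := by
  obtain ⟨Z, hZ⟩ := le_iff.1 hxy
  refine le_iff.2 ⟨Z, add_left_cancel_of (A := C) (d := y) ?_ (by rw [add_comm, hy])⟩
  rw [← add_assoc, add_comm C, hx, hZ]

theorem le_of_sub_anti {a b c d s : E} (h1 : of a + of c = of s) (h2 : of b + of d = of s)
    (hab : a ≤ b) : d ≤ c := by
  obtain ⟨Z, hZ⟩ := le_iff.1 hab
  refine le_iff.2 ⟨Z, add_left_cancel_of (A := of a) (d := s) ?_ h1⟩
  rw [add_comm (of d), ← add_assoc, hZ, h2]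

theorem le_compl_iff {a c : E} : c ≤ EffectAlgebra.compl a ↔ ∃ s, of a + of c = of s := by
  constructor
  · intro h
    obtain ⟨Z, hZ⟩ := le_iff.1 h
    exact exists_of_of_add_eq (B := Z) (c := 1) (by rw [add_assoc, hZ, of_add_compl])
  · rintro ⟨s, hs⟩
    refine le_iff.2 ⟨of (EffectAlgebra.compl s), eq_compl ?_⟩
    rw [← add_assoc, hs, of_add_compl]

theorem le_compl_comm {a c : E} :
    c ≤ EffectAlgebra.compl a ↔ a ≤ EffectAlgebra.compl c := by
  rw [le_compl_iff, le_compl_iff, add_comm]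

theorem compl_le_comm {a c : E} :
    EffectAlgebra.compl a ≤ c ↔ EffectAlgebra.compl c ≤ a := by
  conv_lhs => rw [← PartialSum.compl_compl c, le_compl_comm, PartialSum.compl_compl]

/-- This form avoids meets and joins: any splitting of `y` into a part below `x` and a part
orthogonal to `x` suffices. -/
theorem compatible_iff {x y : E} : Compatible x y ↔
    ∃ d c, of d + of c = of y ∧ d ≤ x ∧ c ≤ EffectAlgebra.compl x := by
  constructor
  · rintro ⟨c, h1, h2⟩
    exact ⟨x ⊓ y, c, h1, inf_le_left, le_compl_iff.2 ⟨_, h2⟩⟩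
  · rintro ⟨d, c, hdc, hd, hc⟩
    obtain ⟨c₀, hc₀⟩ := exists_add_eq (inf_le_right : x ⊓ y ≤ y)
    have hdy : d ≤ x ⊓ y := le_inf hd (le_of_add_eq hdc)
    obtain ⟨s, hs⟩ := le_compl_iff.1 ((le_of_sub_anti hdc hc₀ hdy).trans hc)
    obtain ⟨e, he⟩ := exists_add_eq (inf_le_left : x ⊓ y ≤ x)
    have hye : of y + of e = of s := by rw [← hc₀, add_right_comm, he, hs]
    have hle : x ⊔ y ≤ s := sup_le (le_of_add_eq hs) (le_of_add_eq hye)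
    -- The excess `r` of `x ⊕ c₀` over `x ∨ y` fits into both differences, so `(x ∧ y) ⊕ r` is still
    -- below `x` and `y`; this forces `r = 0`.
    obtain ⟨r, hr⟩ := exists_add_eq hle
    have hrc : r ≤ c₀ := le_of_sub_anti hs hr le_sup_left
    have hre : r ≤ e := le_of_sub_anti hye hr le_sup_right
    rw [add_comm] at hc₀ he
    obtain ⟨t, ht, hty⟩ := exists_add_of_le hrc hc₀
    obtain ⟨t', ht', htx⟩ := exists_add_of_le hre he
    obtain rfl : t = t' := of_injective (ht.symm.trans ht')
    have hte : t = x ⊓ y := le_antisymm (le_inf htx hty) (le_of_add_eq' ht)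
    have hr0 : of r = 0 := by
      refine add_left_cancel_of (A := of (x ⊓ y)) (d := x ⊓ y) ?_ (add_zero _)
      rw [add_comm, ht, hte]
    rw [hr0, add_zero] at hr
    refine ⟨c₀, ?_, ?_⟩
    · change of (x ⊓ y) + of c₀ = of y
      rwa [add_comm]
    · change of x + of c₀ = of (x ⊔ y)
      rw [hs, hr]

theorem Compatible.exists_add {x y : E} (h : Compatible x y) :
    ∃ c, of (x ⊓ y) + of c = of y ∧ of x + of c = of (x ⊔ y) := h

theorem Compatible.symm {x y : E} (h : Compatible x y) : Compatible y x := by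
  obtain ⟨c, h1, h2⟩ := h.exists_add
  obtain ⟨e, he⟩ := exists_add_eq (inf_le_left : x ⊓ y ≤ x)
  refine compatible_iff.2 ⟨x ⊓ y, e, he, inf_le_right, le_compl_iff.2 ⟨x ⊔ y, ?_⟩⟩
  rw [← h1, add_right_comm, he, h2]

theorem Compatible.compl_left {x y : E} (h : Compatible x y) :
    Compatible (EffectAlgebra.compl x) y := by
  obtain ⟨d, c, h1, h2, h3⟩ := compatible_iff.1 h
  exact compatible_iff.2 ⟨c, d, by rwa [add_comm], h3, by rwa [PartialSum.compl_compl]⟩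

theorem Compatible.compl_right {x y : E} (h : Compatible x y) :
    Compatible x (EffectAlgebra.compl y) :=
  h.symm.compl_left.symm

theorem compatible_of_le {x y : E} (h : y ≤ x) : Compatible x y :=
  compatible_iff.2 ⟨y, 0, add_zero _, h, nonneg _⟩

theorem compatible_of_le_compl {x y : E} (h : y ≤ EffectAlgebra.compl x) : Compatible x y :=
  compatible_iff.2 ⟨0, y, zero_add _, nonneg _, h⟩

/-- Subtract the canonical splittings of `a` and `b` along `c` part by part; this splits `d` along
`c`. -/
theorem Compatible.sub_right {a b c d : E} (ha : Compatible c a) (hb : Compatible c b)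
    (h : of a + of d = of b) : Compatible c d := by
  obtain ⟨q, hq, hq'⟩ := hb.exists_add
  obtain ⟨r, hr, hr'⟩ := ha.exists_add
  have hab : a ≤ b := le_of_add_eq h
  obtain ⟨p, hp⟩ := exists_add_eq (inf_le_inf_left c hab)
  have hrq : r ≤ q := by
    rw [add_comm] at hq' hr'
    exact le_of_add_le_add_of hr' hq' (sup_le_sup_left hab c)
  obtain ⟨t, ht⟩ := exists_add_eq hrq
  have hpt : of p + of t = of d := by
    refine add_left_cancel_of (A := of a) (d := b) ?_ h
    rw [← hr, ← hq, ← hp, ← ht]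
    abel
  refine compatible_iff.2 ⟨p, t, hpt, (le_of_add_eq' hp).trans inf_le_left, ?_⟩
  exact (le_of_add_eq' ht).trans (le_compl_iff.2 ⟨_, hq'⟩)

/-- Dual to differences, because `s' = a' ⊖ b`. -/
theorem Compatible.add_right {a b c s : E} (ha : Compatible c a) (hb : Compatible c b)
    (h : of a + of b = of s) : Compatible c s := by
  have h1 : of b + of (EffectAlgebra.compl s) = of (EffectAlgebra.compl a) := by
    apply eq_compl
    rw [← add_assoc, h, of_add_compl]
  have := (Compatible.sub_right hb ha.compl_right h1).compl_right
  rwa [PartialSum.compl_compl] at this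

/-- The remainder `y ⊖ (x ∧ y)` is orthogonal to every `z ∈ S`, hence to their supremum. -/
theorem Compatible.isLUB_left {S : Set E} {x y : E} (hx : IsLUB S x)
    (h : ∀ z ∈ S, Compatible z y) : Compatible x y := by
  obtain ⟨c, hc⟩ := exists_add_eq (inf_le_right : x ⊓ y ≤ y)
  refine compatible_iff.2 ⟨x ⊓ y, c, hc, inf_le_left, le_compl_comm.1 (hx.2 fun z hz => ?_)⟩
  obtain ⟨d, hd, hd'⟩ := (h z hz).exists_add
  have : c ≤ d := le_of_sub_anti hd hc (inf_le_inf_right y (hx.1 hz))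
  exact le_compl_comm.1 (this.trans (le_compl_iff.2 ⟨_, hd'⟩))

theorem isLUB_compl_image {S : Set E} {x : E} (hx : IsGLB S x) :
    IsLUB (EffectAlgebra.compl '' S) (EffectAlgebra.compl x) := by
  constructor
  · rintro _ ⟨z, hz, rfl⟩
    rw [compl_le_comm, PartialSum.compl_compl]
    exact hx.1 hz
  · intro b hb
    rw [compl_le_comm]
    exact hx.2 fun z hz => compl_le_comm.1 (hb ⟨z, hz, rfl⟩)

/-- In a complete lattice effect algebra no nonzero element has all its multiples. -/
theorem exists_nsmul_ne_of_isCompleteLat (hE : IsCompleteLat E) {x : E} (hx : x ≠ 0) :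
    ∃ n : ℕ, ∀ y, n • of x ≠ of y := by
  by_contra! h
  choose f hf using h
  obtain ⟨s, hs⟩ := (hE (Set.range f)).1
  have hsucc (n : ℕ) : of (f n) + of x = of (f (n + 1)) := by
    rw [← hf, ← hf, succ_nsmul]
  have hxs : x ≤ s := (le_of_add_eq' (hsucc 0)).trans (hs.1 ⟨1, rfl⟩)
  obtain ⟨t, ht⟩ := exists_add_eq hxs
  -- Since `(n + 1)x ≤ s`, the element `t = s ⊖ x` already bounds every `nx`.
  have hst : s ≤ t := by
    refine hs.2 ?_
    rintro _ ⟨n, rfl⟩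
    rw [add_comm] at ht
    exact le_of_add_le_add_of (hsucc n) ht (hs.1 ⟨n + 1, rfl⟩)
  obtain rfl : s = t := le_antisymm hst (le_of_add_eq' ht)
  rw [add_comm] at ht
  exact hx (of_injective (add_left_cancel_of ht (add_zero _)))

theorem exists_nsmul_ne_of_isArchimedean (hE : IsArchimedean E) {x : E} (hx : x ≠ 0) :
    ∃ n : ℕ, ∀ y, n • of x ≠ of y := by
  by_contra! h
  refine (hE x hx).ne ((ENat.eq_top_iff_forall_ge).2 fun n => ?_)
  obtain ⟨y, hy⟩ := h n
  rw [nsmul_of] at hy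
  have hy' : multiple n x = some y := hy
  exact le_iSup (fun n : {n : ℕ // (multiple n x).isSome} => (n.1 : ℕ∞)) ⟨n, by rw [hy']; rfl⟩

theorem exists_greatest_nsmul {x : E} (h : ∃ n : ℕ, ∀ y, n • of x ≠ of y) :
    ∃ (n : ℕ) (e : E), n • of x = of e ∧ ∀ (m : ℕ) y, n < m → m • of x ≠ of y := by
  classical
  obtain ⟨n, hn⟩ : ∃ n, Nat.find h = n + 1 := by
    refine Nat.exists_eq_succ_of_ne_zero fun h0 => ?_
    have := Nat.find_spec h 0
    rw [h0] at this
    exact this (zero_nsmul _)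
  have h1 := Nat.find_min h (m := n) (by omega)
  push Not at h1
  obtain ⟨e, he⟩ := h1
  refine ⟨n, e, he, fun m y hm hy => ?_⟩
  obtain ⟨k, rfl⟩ := Nat.exists_eq_add_of_le hm
  have h2 := Nat.find_spec h
  rw [hn] at h2
  rw [add_nsmul] at hy
  obtain ⟨z, hz⟩ := exists_of_of_add_eq hy
  exact h2 z hz

/-! ### Blocks and their atoms -/

variable {B : Set E}

theorem exists_isBlock_superset {S : Set E} (hS : ∀ x ∈ S, ∀ y ∈ S, Compatible x y) :
    ∃ B, S ⊆ B ∧ IsBlock B := by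
  refine zorn_subset_nonempty {S : Set E | ∀ x ∈ S, ∀ y ∈ S, Compatible x y} ?_ S hS
  intro c hc hchain _
  refine ⟨⋃₀ c, ?_, fun s hs => Set.subset_sUnion_of_mem hs⟩
  rintro x ⟨s, hs, hxs⟩ y ⟨t, ht, hyt⟩
  rcases hchain.total hs ht with h | h
  · exact hc ht x (h hxs) y hyt
  · exact hc hs x hxs y (h hyt)

theorem IsMV.isBlock_univ (h : IsMV E) : IsBlock (Set.univ : Set E) :=
  ⟨fun x _ y _ => h x y, fun _ _ _ => Set.subset_univ _⟩

namespace IsBlock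

/-- Maximality turns each closure property of blocks into one of compatibility. -/
theorem mem_iff (hB : IsBlock B) {x : E} : x ∈ B ↔ ∀ y ∈ B, Compatible x y := by
  refine ⟨fun hx y hy => hB.1 x hx y hy, fun h => ?_⟩
  refine hB.2 (y := insert x B) ?_ (Set.subset_insert x B) (Set.mem_insert x B)
  rintro y (rfl | hy) z (rfl | hz)
  · exact compatible_of_le le_rfl
  · exact h z hz
  · exact (h y hy).symm
  · exact hB.1 y hy z hz

theorem compl_mem (hB : IsBlock B) {x : E} (hx : x ∈ B) : EffectAlgebra.compl x ∈ B :=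
  hB.mem_iff.2 fun y hy => (hB.1 x hx y hy).compl_left

theorem sub_mem (hB : IsBlock B) {a b d : E} (ha : a ∈ B) (hb : b ∈ B)
    (h : of a + of d = of b) : d ∈ B :=
  hB.mem_iff.2 fun y hy => (Compatible.sub_right (hB.1 y hy a ha) (hB.1 y hy b hb) h).symm

theorem add_mem (hB : IsBlock B) {a b s : E} (ha : a ∈ B) (hb : b ∈ B)
    (h : of a + of b = of s) : s ∈ B :=
  hB.mem_iff.2 fun y hy => (Compatible.add_right (hB.1 y hy a ha) (hB.1 y hy b hb) h).symm

theorem zero_mem (hB : IsBlock B) : (0 : E) ∈ B :=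
  hB.mem_iff.2 fun y _ => (compatible_of_le (nonneg y)).symm

theorem isLUB_mem (hB : IsBlock B) {S : Set E} {x : E} (hS : S ⊆ B) (hx : IsLUB S x) : x ∈ B :=
  hB.mem_iff.2 fun y hy => Compatible.isLUB_left hx fun z hz => hB.1 z (hS hz) y hy

theorem isGLB_mem (hB : IsBlock B) {S : Set E} {x : E} (hS : S ⊆ B) (hx : IsGLB S x) : x ∈ B := by
  rw [← PartialSum.compl_compl x]
  refine hB.compl_mem (hB.isLUB_mem ?_ (isLUB_compl_image hx))
  rintro _ ⟨z, hz, rfl⟩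
  exact hB.compl_mem (hS hz)

theorem inf_mem (hB : IsBlock B) {x y : E} (hx : x ∈ B) (hy : y ∈ B) : x ⊓ y ∈ B :=
  hB.isGLB_mem (Set.insert_subset hx (Set.singleton_subset_iff.2 hy)) isGLB_pair

theorem nsmul_mem (hB : IsBlock B) {a : E} (ha : a ∈ B) (n : ℕ) :
    ∀ {e : E}, n • of a = of e → e ∈ B := by
  induction n with
  | zero =>
    intro e he
    rw [zero_nsmul, ← of_zero] at he
    exact of_injective he ▸ hB.zero_mem
  | succ n ih =>
    intro e he
    rw [succ_nsmul] at he
    obtain ⟨d, hd⟩ := exists_of_of_add_eq he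
    rw [hd] at he
    exact hB.add_mem (ih hd) ha he

end IsBlock

/-- `a` is an atom of the set `B`, that is, a minimal nonzero element of `B`. -/
def IsAtomIn (B : Set E) (a : E) : Prop :=
  a ∈ B ∧ a ≠ 0 ∧ ∀ z ∈ B, z ≤ a → z = 0 ∨ z = a

theorem isAtomIn_of_isAtom {a : E} (ha : IsAtom a) (haB : a ∈ B) : IsAtomIn B a :=
  ⟨haB, ha.1, fun _ _ hz => ha.le_iff.1 hz⟩

/-- Since `w ∧ a = 0`, compatibility gives `w ⊕ a = w ∨ a ≤ (n + 1)a`; cancelling `a` lowers `n`. -/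
theorem IsAtomIn.eq_zero_of_le_nsmul (hB : IsBlock B) {a w : E} (ha : IsAtomIn B a) (hw : w ∈ B)
    (haw : ¬ a ≤ w) (n : ℕ) : ∀ {e : E}, n • of a = of e → w ≤ e → w = 0 := by
  induction n with
  | zero =>
    intro e he hwe
    rw [zero_nsmul, ← of_zero] at he
    exact eq_zero_of_le_zero (of_injective he ▸ hwe)
  | succ n ih =>
    intro e he hwe
    obtain ⟨c, hc, hc'⟩ := (hB.1 w hw a ha.1).exists_add
    have h0 : w ⊓ a = 0 := by
      refine (ha.2.2 _ (hB.inf_mem hw ha.1) inf_le_right).resolve_right fun h => haw ?_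
      exact inf_eq_right.1 h
    rw [h0, of_zero, zero_add] at hc
    rw [hc] at hc'
    rw [succ_nsmul] at he
    obtain ⟨d, hd⟩ := exists_of_of_add_eq he
    refine ih hd (le_of_add_le_add_of hc' (hd ▸ he) (sup_le hwe ?_))
    exact le_of_add_eq' he

/-- In a block, the multiple `k a` of an atom `a` with `n = ord a` is not below `x` exactly when
`(n + 1 - k) a` is below `x'`. -/
theorem IsAtomIn.exists_not_le_iff (hB : IsBlock B) {a : E} (ha : IsAtomIn B a)
    (harch : ∃ n : ℕ, ∀ y, n • of a ≠ of y) {l : ℕ} {u : E} (hl : 1 ≤ l) (hu : l • of a = of u) :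
    ∃ (m : ℕ) (w : E), 1 ≤ m ∧ m • of a = of w ∧
      ∀ x ∈ B, ¬ u ≤ x ↔ x ≤ EffectAlgebra.compl w := by
  obtain ⟨n, e, hne, hmax⟩ := exists_greatest_nsmul harch
  have hln : l ≤ n := by
    by_contra h
    exact hmax l u (by omega) hu
  have hsplit : n • of a = (n + 1 - l) • of a + (l - 1) • of a := by
    rw [← add_nsmul]
    congr 1
    omega
  obtain ⟨w, hw⟩ := exists_of_of_add_eq (hsplit.symm.trans hne)
  refine ⟨n + 1 - l, w, by omega, hw, fun x hx => ⟨fun hux => ?_, fun hxw hux => ?_⟩⟩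
  · classical
    -- Remove `a` from `x` as often as possible; the remainder `y` is no longer above `a`.
    let P : ℕ → Prop := fun k => ∃ y, k • of a + of y = of x
    have hP0 : P 0 := ⟨x, by rw [zero_nsmul, zero_add]⟩
    obtain ⟨y, hy⟩ : P (Nat.findGreatest P n) := Nat.findGreatest_spec (Nat.zero_le n) hP0
    have hkn : Nat.findGreatest P n ≤ n := Nat.findGreatest_le n
    have hkmax : ∀ k, Nat.findGreatest P n < k → ¬ P k := by
      intro k hk hPk
      by_cases hkn' : k ≤ n
      · exact Nat.findGreatest_is_greatest hk hkn' hPk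
      · obtain ⟨z, hz⟩ := hPk
        obtain ⟨f, hf⟩ := exists_of_of_add_eq hz
        exact hmax k f (by omega) hf
    generalize Nat.findGreatest P n = k at hy hkn hkmax
    obtain ⟨f, hf⟩ := exists_of_of_add_eq hy
    have hyB : y ∈ B := by
      rw [hf] at hy
      exact hB.sub_mem (hB.nsmul_mem ha.1 k hf) hx hy
    have hay : ¬ a ≤ y := by
      intro h
      obtain ⟨z, hz⟩ := exists_add_eq h
      refine hkmax (k + 1) (Nat.lt_succ_self k) ⟨z, ?_⟩
      rw [succ_nsmul, add_assoc, hz, hy]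
    have heB := hB.nsmul_mem ha.1 n hne
    -- Disjointness and compatibility make `y ⊕ na` defined.
    have h0 : y ⊓ e = 0 :=
      ha.eq_zero_of_le_nsmul hB (hB.inf_mem hyB heB) (fun h => hay (h.trans inf_le_left)) n hne
        inf_le_right
    obtain ⟨c, hc, hc'⟩ := (hB.1 y hyB e heB).exists_add
    rw [h0, of_zero, zero_add] at hc
    have hkl : k < l := by
      by_contra h
      refine hux (le_iff.2 ⟨(k - l) • of a + of y, ?_⟩)
      rw [← hu, ← add_assoc, ← add_nsmul, ← hy]
      congr 3
      omega
    rw [le_compl_comm, le_compl_iff]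
    -- As `k < l`, the sum `x ⊕ (n + 1 - l)a` needs only `n - (l - 1 - k)` copies of `a` besides
    -- `y`; padding it gives `y ⊕ na`.
    refine exists_of_of_add_eq (B := (l - 1 - k) • of a) (c := y ⊔ e) ?_
    rw [← hc', hc, ← hne, ← hy, ← hw]
    have : n = k + (n + 1 - l) + (l - 1 - k) := by omega
    conv_rhs => rw [this, add_nsmul, add_nsmul]
    abel
  · obtain ⟨Z, hZ⟩ := le_iff.1 hux
    obtain ⟨s, hs⟩ := le_compl_iff.1 hxw
    -- Both conditions together would make `(n + 1)a` exist.
    have h1 : (n + 1) • of a + Z = of s := by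
      rw [← hs, ← hZ, ← hu, ← hw, ← add_assoc, ← add_nsmul]
      congr 2
      omega
    obtain ⟨t, ht⟩ := exists_of_of_add_eq h1
    exact hmax _ _ (Nat.lt_succ_self n) ht

/-- In a block-finite lattice effect algebra, a sequence of orthogonal elements has a member below
which any two elements are compatible. -/
theorem IsBlockFinite.exists_compatible_below (hE : IsBlockFinite E) (x : ℕ → E)
    (hx : ∀ i j, i < j → x j ≤ EffectAlgebra.compl (x i)) :
    ∃ i, ∀ y z, y ≤ x i → z ≤ x i → Compatible y z := by
  by_contra! h
  choose y z hy hz hyz using h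
  have horth : ∀ i j, i ≠ j → ∀ s t, s ≤ x i → t ≤ x j → Compatible s t := by
    have key : ∀ i j, i < j → ∀ s t, s ≤ x i → t ≤ x j → Compatible s t := fun i j hij s t hs ht =>
      compatible_of_le_compl (ht.trans (le_compl_comm.1 (hs.trans (le_compl_comm.1 (hx i j hij)))))
    intro i j hij s t hs ht
    rcases lt_or_gt_of_ne hij with h | h
    · exact key i j h s t hs ht
    · exact (key j i h t s ht hs).symm
  -- A block containing the `n`-th family contains `y n` and so excludes `z n`, which all the other
  -- families contain. Infinitely many distinct blocks result.
  let g : ℕ → ℕ → E := fun n i => if i = n then y i else z i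
  have hg : ∀ n i, g n i ≤ x i := by
    intro n i
    by_cases h : i = n
    · simpa [g, h] using hy n
    · simpa [g, h] using hz i
  have hpair : ∀ n, ∀ s ∈ Set.range (g n), ∀ t ∈ Set.range (g n), Compatible s t := by
    rintro n _ ⟨i, rfl⟩ _ ⟨j, rfl⟩
    by_cases hij : i = j
    · subst hij
      exact compatible_of_le le_rfl
    · exact horth i j hij _ _ (hg n i) (hg n j)
  choose D hD hDB using fun n => exists_isBlock_superset (hpair n)
  have hinj : Function.Injective D := by
    intro m n hmn
    by_contra hne
    have h1 : y m ∈ D m := hD m ⟨m, by simp [g]⟩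
    have h2 : z m ∈ D m := by
      rw [hmn]
      exact hD n ⟨m, by simp [g, hne]⟩
    exact hyz m ((hDB m).1 _ h1 _ h2)
  exact Set.infinite_of_injective_forall_mem hinj hDB hE

theorem IsBlock.exists_isAtomIn_le (hB : IsBlock B) (hat : IsAtomic E) (hE : IsBlockFinite E)
    {b : E} (hb : b ∈ B) (hb0 : b ≠ 0) : ∃ a, IsAtomIn B a ∧ a ≤ b := by
  by_contra! hno
  -- Without atoms of `B` below `b`, nonzero pieces `p` can be split off forever, giving an
  -- orthogonal sequence in `B`.
  have hstep : ∀ r : {r : E // r ∈ B ∧ r ≠ 0 ∧ r ≤ b},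
      ∃ (p : E) (q : {r : E // r ∈ B ∧ r ≠ 0 ∧ r ≤ b}), p ∈ B ∧ p ≠ 0 ∧ of p + of q.1 = of r.1 := by
    rintro ⟨r, hrB, hr0, hrb⟩
    have : ¬ IsAtomIn B r := fun h => hno r h hrb
    simp only [IsAtomIn, not_and, not_forall, not_or] at this
    obtain ⟨p, hpB, hpr, hp0, hpne⟩ := this hrB hr0
    obtain ⟨q, hq⟩ := exists_add_eq hpr
    refine ⟨p, ⟨q, hB.sub_mem hpB hrB hq, ?_, (le_of_add_eq' hq).trans hrb⟩, hpB, hp0, hq⟩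
    rintro rfl
    rw [of_zero, add_zero] at hq
    exact hpne (of_injective hq)
  choose p q hpB hp0 hpq using hstep
  let r : ℕ → {r : E // r ∈ B ∧ r ≠ 0 ∧ r ≤ b} := fun n => q^[n] ⟨b, hb, hb0, le_rfl⟩
  have hr : ∀ n, of (p (r n)) + of (r (n + 1)).1 = of (r n).1 := by
    intro n
    have : r (n + 1) = q (r n) := Function.iterate_succ_apply' q n _
    rw [this]
    exact hpq (r n)
  have hanti : Antitone fun n => (r n).1 := antitone_nat_of_succ_le fun n => le_of_add_eq' (hr n)
  obtain ⟨i, hi⟩ := hE.exists_compatible_below (fun n => p (r n)) fun i j hij =>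
    (le_of_add_eq (hr j)).trans ((hanti (Nat.succ_le_of_lt hij)).trans (le_compl_iff.2 ⟨_, hr i⟩))
  obtain h0 | ⟨a, ha, hap⟩ := hat.eq_bot_or_exists_atom_le (p (r i))
  · exact hp0 _ h0
  refine hno a (isAtomIn_of_isAtom ha (hB.mem_iff.2 fun y hy => ?_))
    (hap.trans ((le_of_add_eq (hr i)).trans (r i).2.2.2))
  -- Split `y` along `p (r i)`: `a` is compatible with the part below `p (r i)` by the choice of
  -- `i`, and orthogonal to the rest. So this atom of `E` lies in `B`.
  obtain ⟨c, hc, hc'⟩ := (hB.1 _ (hpB (r i)) y hy).exists_add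
  refine Compatible.add_right (hi _ _ hap inf_le_left) (compatible_of_le_compl ?_) hc
  exact le_compl_comm.1 (hap.trans (le_compl_comm.1 (le_compl_iff.2 ⟨_, hc'⟩)))

/-- Otherwise take an atom `a ≤ x ⊖ (x ∧ c)`. If `ka ≤ x ∧ c`, then `(k + 1)a ≤ x`, hence also `(k +
1)a ≤ c`; so all multiples of `a` would exist. -/
theorem le_of_forall_finJoins_le (hat : IsAtomic E)
    (harch : ∀ x : E, x ≠ 0 → ∃ n : ℕ, ∀ y, n • of x ≠ of y) {x c : E}
    (h : ∀ u ∈ finJoins E, u ≤ x → u ≤ c) : x ≤ c := by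
  obtain ⟨d, hd⟩ := exists_add_eq (inf_le_left : x ⊓ c ≤ x)
  obtain h0 | ⟨a, ha, had⟩ := hat.eq_bot_or_exists_atom_le d
  · have h0 : d = 0 := h0
    rw [h0, of_zero, add_zero] at hd
    exact inf_eq_left.1 (of_injective hd)
  obtain ⟨n, hn⟩ := harch a ha.1
  exfalso
  obtain ⟨Z, hZ⟩ := le_iff.1 had
  have key : ∀ k : ℕ, ∃ y, k • of a = of y ∧ y ≤ x ⊓ c := by
    intro k
    induction k with
    | zero => exact ⟨0, zero_nsmul _, nonneg _⟩
    | succ k ih =>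
      obtain ⟨y, hy, hyx⟩ := ih
      obtain ⟨W, hW⟩ := le_iff.1 hyx
      have h1 : (k + 1) • of a + (W + Z) = of x := by
        rw [← hd, ← hW, ← hZ, ← hy, succ_nsmul]
        abel
      obtain ⟨t, ht⟩ := exists_of_of_add_eq h1
      have htx : t ≤ x := le_of_add_eq (ht ▸ h1)
      refine ⟨t, ht, le_inf htx (h t ⟨{t}, ?_, by simp⟩ htx)⟩
      intro s hs
      rw [Finset.mem_singleton.1 hs]
      exact ⟨a, k + 1, ha, by omega, by rw [← nsmul_of]; exact ht⟩
  obtain ⟨y, hy, -⟩ := key n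
  exact hn y hy

end LatticeEffectAlgebra

/-! ### Interval and order topologies of a lattice -/

section LatticeTopologies

open Filter Set Topology

variable {L : Type u} [Lattice L]

theorem isClosed_Icc_intervalTop {a b : L} (h : a ≤ b) : IsClosed[intervalTop L] (Icc a b) :=
  @IsClosed.mk L (intervalTop L) _ <|
    TopologicalSpace.isOpen_generateFrom_of_mem ⟨a, b, h, rfl⟩

theorem isClosed_Ici_intervalTop [BoundedOrder L] (a : L) : IsClosed[intervalTop L] (Ici a) := by
  rw [← Icc_top]
  exact isClosed_Icc_intervalTop le_top

theorem isClosed_Iic_intervalTop [BoundedOrder L] (a : L) : IsClosed[intervalTop L] (Iic a) := by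
  rw [← Icc_bot]
  exact isClosed_Icc_intervalTop bot_le

theorem mem_of_isClosed_of_le_nhds {X : Type*} (t : TopologicalSpace X) {F : Filter X} [F.NeBot]
    {x : X} {s : Set X} (hs : IsClosed[t] s) (hF : F ≤ @nhds X t x) (hsF : s ∈ F) : x ∈ s :=
  hs.mem_of_frequently_of_tendsto (f := id) (Eventually.frequently hsF) hF

theorem OrderConverges.tendsto_intervalTop {J : Type v} [Preorder J] [IsDirectedOrder J]
    [Nonempty J] {x : J → L} {a : L} (h : OrderConverges x a) :
    Tendsto x atTop (@nhds L (intervalTop L) a) := by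
  obtain ⟨p, q, hpq, hp, hpa, hq, hqa⟩ := h
  refine TopologicalSpace.tendsto_nhds_generateFrom_iff.2 ?_
  rintro _ ⟨b, c, -, rfl⟩ ha
  by_contra hx
  have hx : ∃ᶠ j in atTop, x j ∈ Icc b c := by
    intro h
    exact hx h
  -- Returning to `[b, c]` cofinally forces `b ≤ q j` and `p j ≤ c` for all `j`, hence `a ∈ [b, c]`.
  refine ha ⟨hqa.2 ?_, hpa.2 ?_⟩
  · rintro _ ⟨j, rfl⟩
    obtain ⟨i, hi, hji⟩ := (hx.and_eventually (eventually_ge_atTop j)).exists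
    exact hi.1.trans ((hpq i).2.trans (hq hji))
  · rintro _ ⟨j, rfl⟩
    obtain ⟨i, hi, hji⟩ := (hx.and_eventually (eventually_ge_atTop j)).exists
    exact (hp hji).trans ((hpq i).1.trans hi.2)

theorem orderTop_le_intervalTop : orderTop L ≤ intervalTop L :=
  sInf_le fun _ _ _ _ _ _ h => h.tendsto_intervalTop

theorem OrderConverges.tendsto_orderTop {J : Type u} [Preorder J] [IsDirectedOrder J]
    [Nonempty J] {x : J → L} {a : L} (h : OrderConverges x a) :
    Tendsto x atTop (@nhds L (orderTop L) a) := by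
  rw [orderTop, nhds_sInf]
  exact tendsto_iInf.2 fun t => tendsto_iInf.2 fun ht => ht J x a h

/-- A filter that contains enough intervals around `m` converges to `m` in the order topology. -/
theorem le_nhds_orderTop [BoundedOrder L] {F : Filter L} [F.NeBot] {P Q : Set L} {m : L}
    (hP : ∀ p ∈ P, Ici p ∈ F) (hPm : IsLUB P m) (hQ : ∀ q ∈ Q, Iic q ∈ F) (hQm : IsGLB Q m) :
    F ≤ @nhds L (orderTop L) m := by
  intro U hU
  by_contra hUF
  -- Indexing by all intervals in `F` and choosing a point outside `U` in each yields a net that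
  -- order converges to `m` but never enters `U`.
  let J := {r : L × Lᵒᵈ // Ici r.1 ∈ F ∧ Iic (OrderDual.ofDual r.2) ∈ F}
  have hne (p q : L) (hp : Ici p ∈ F) (hq : Iic q ∈ F) : p ≤ q := by
    obtain ⟨y, hy, hy'⟩ := F.nonempty_of_mem (inter_mem hp hq)
    exact le_trans hy hy'
  have hex (r : J) : ∃ y, y ∉ U ∧ r.1.1 ≤ y ∧ y ≤ OrderDual.ofDual r.1.2 := by
    by_contra! h
    refine hUF (mem_of_superset (inter_mem r.2.1 r.2.2) fun y hy => ?_)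
    by_contra hyU
    exact h y hyU hy.1 hy.2
  choose x hxU hx1 hx2 using hex
  have : Nonempty J := ⟨⟨(⊥, OrderDual.toDual ⊤), by simp⟩⟩
  have : IsDirectedOrder J := ⟨fun r s => by
    refine ⟨⟨(r.1.1 ⊔ s.1.1, r.1.2 ⊔ s.1.2), ?_, ?_⟩, ?_, ?_⟩
    · filter_upwards [r.2.1, s.2.1] with y h1 h2 using sup_le h1 h2
    · filter_upwards [r.2.2, s.2.2] with y h1 h2 using le_inf h1 h2
    · exact ⟨le_sup_left, le_sup_left⟩
    · exact ⟨le_sup_right, le_sup_right⟩⟩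
  have hconv : OrderConverges x m := by
    refine ⟨fun r => r.1.1, fun r => OrderDual.ofDual r.1.2, fun r => ⟨hx1 r, hx2 r⟩,
      fun r s h => h.1, ⟨?_, fun b hb => hPm.2 fun p hp => ?_⟩, fun r s h => h.2,
      ⟨?_, fun b hb => hQm.2 fun q hq => ?_⟩⟩
    · rintro _ ⟨r, rfl⟩
      exact hQm.2 fun q hq => hne _ _ r.2.1 (hQ q hq)
    · exact hb ⟨⟨(p, OrderDual.toDual ⊤), hP p hp, by simp⟩, rfl⟩
    · rintro _ ⟨r, rfl⟩
      exact hPm.2 fun p hp => hne _ _ (hP p hp) r.2.2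
    · exact hb ⟨⟨(⊥, OrderDual.toDual q), by simp, hQ q hq⟩, rfl⟩
  obtain ⟨r, hr⟩ := (hconv.tendsto_orderTop.eventually_mem hU).exists
  exact hxU r hr

theorem IsCompleteLat.compactSpace_intervalTop [BoundedOrder L] (hL : IsCompleteLat L) :
    @CompactSpace L (intervalTop L) := by
  let := intervalTop L
  refine ⟨isCompact_iff_ultrafilter_le_nhds.2 fun F _ => ?_⟩
  obtain ⟨m, hm⟩ := (hL {p | Ici p ∈ F}).1
  refine ⟨m, mem_univ m, ?_⟩
  refine TopologicalSpace.tendsto_nhds_generateFrom_iff (m := id).2 ?_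
  rintro _ ⟨a, b, -, rfl⟩ hmab
  refine Ultrafilter.compl_mem_iff_notMem.2 fun hab => hmab ⟨hm.1 ?_, hm.2 fun p hp => ?_⟩
  · exact mem_of_superset hab fun y hy => hy.1
  · obtain ⟨y, hy, hpy⟩ := F.nonempty_of_mem (inter_mem hab hp)
    exact le_trans hpy hy.2

theorem isCompleteLat_of_compactSpace [BoundedOrder L] (h : @CompactSpace L (intervalTop L)) :
    IsCompleteLat L := by
  have hlub (S : Set L) : ∃ a, IsLUB S a := by
    let := intervalTop L
    -- A common point of these intervals is a supremum. Inserting `⊥` keeps the upper bounds in play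
    -- when `S` is empty.
    let C : ↥(insert ⊥ S) × upperBounds S → Set L := fun r => Icc r.1.1 r.2.1
    have hC (s : ↥(insert ⊥ S)) (b : upperBounds S) : s.1 ≤ b.1 := by
      rcases s.2 with h | h
      · exact h.le.trans bot_le
      · exact b.2 h
    have := isCompact_univ.inter_iInter_nonempty (X := L) C
      (fun r => isClosed_Icc_intervalTop (hC r.1 r.2)) fun u => by
        classical
        refine ⟨(u.image fun r => r.1.1).sup id, mem_univ _, mem_iInter₂.2 fun r hr => ⟨?_, ?_⟩⟩
        · exact Finset.le_sup (f := id) (Finset.mem_image_of_mem (fun r => r.1.1) hr)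
        · refine Finset.sup_le fun y hy => ?_
          obtain ⟨s, -, rfl⟩ := Finset.mem_image.1 hy
          exact hC s.1 r.2
    obtain ⟨z, -, hz⟩ := this
    rw [mem_iInter] at hz
    exact ⟨z, fun s hs => (hz (⟨s, Or.inr hs⟩, ⟨⊤, fun _ _ => le_top⟩)).1,
      fun b hb => (hz (⟨⊥, Or.inl rfl⟩, ⟨b, hb⟩)).2⟩
  refine fun S => ⟨hlub S, ?_⟩
  obtain ⟨a, ha⟩ := hlub (lowerBounds S)
  exact ⟨a, isLUB_lowerBounds.1 ha⟩

end LatticeTopologies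

/-! ### The topology `τ_Φ` -/

namespace LatticeEffectAlgebra

open PartialSum Filter Set Topology

variable {E : Type u} [LatticeEffectAlgebra E]

theorem tauPhi_eq_iInf :
    tauPhi E = ⨅ φ : Phi E, TopologicalSpace.induced φ.1 inferInstance :=
  UniformSpace.toTopologicalSpace_iInf

theorem isOpen_of_continuous_indicator_one {X : Type*} [TopologicalSpace X] {s : Set X}
    (h : Continuous (s.indicator fun _ => (1 : ℝ))) : IsOpen s := by
  have : s = (s.indicator fun _ => (1 : ℝ)) ⁻¹' Ioi 0 := by
    ext x
    by_cases hx : x ∈ s <;> simp [hx]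
  rw [this]
  exact isOpen_Ioi.preimage h

theorem continuous_tauPhi {φ : E → ℝ} (hφ : φ ∈ Phi E) : @Continuous E ℝ (tauPhi E) _ φ := by
  rw [tauPhi_eq_iInf, continuous_iff_le_induced]
  exact iInf_le (fun φ : Phi E => TopologicalSpace.induced φ.1 inferInstance) ⟨φ, hφ⟩

theorem isOpen_Ici_tauPhi {w : E} (hw : w ∈ finJoins E) : IsOpen[tauPhi E] (Ici w) :=
  @isOpen_of_continuous_indicator_one E (tauPhi E) _ (continuous_tauPhi (Or.inl ⟨w, hw, rfl⟩))

theorem isOpen_Iic_tauPhi {w : E} (hw : EffectAlgebra.compl w ∈ finJoins E) :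
    IsOpen[tauPhi E] (Iic w) :=
  @isOpen_of_continuous_indicator_one E (tauPhi E) _ (continuous_tauPhi (Or.inr ⟨w, hw, rfl⟩))

section Atomic

variable (hat : IsAtomic E) (harch : ∀ x : E, x ≠ 0 → ∃ n : ℕ, ∀ y, n • of x ≠ of y)

include hat harch

theorem isLUB_finJoins (x : E) : IsLUB {u ∈ finJoins E | u ≤ x} x :=
  ⟨fun _ h => h.2, fun _ hb => le_of_forall_finJoins_le hat harch fun _ hu hux => hb ⟨hu, hux⟩⟩

theorem isGLB_compl_finJoins (x : E) :
    IsGLB {w | EffectAlgebra.compl w ∈ finJoins E ∧ x ≤ w} x := by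
  refine ⟨fun _ h => h.2, fun b hb => ?_⟩
  rw [← PartialSum.compl_compl x, le_compl_comm]
  refine le_of_forall_finJoins_le hat harch fun u hu hux => le_compl_comm.1 (hb ⟨?_, ?_⟩)
  · rwa [PartialSum.compl_compl]
  · exact le_compl_comm.1 hux

theorem tauPhi_le_orderTop : tauPhi E ≤ orderTop E :=
  le_of_nhds_le_nhds fun x =>
    @le_nhds_orderTop E _ _ (@nhds E (tauPhi E) x) (@nhds_neBot E (tauPhi E) x) _ _ x
      (fun _ hp => @IsOpen.mem_nhds E (tauPhi E) _ _ (isOpen_Ici_tauPhi hp.1) hp.2)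
      (isLUB_finJoins hat harch x)
      (fun _ hq => @IsOpen.mem_nhds E (tauPhi E) _ _ (isOpen_Iic_tauPhi hq.1) hq.2)
      (isGLB_compl_finJoins hat harch x)

end Atomic

/-! ### Atomic MV-effect algebras -/

section MV

variable (hE : IsMV E) (harch : ∀ x : E, x ≠ 0 → ∃ n : ℕ, ∀ y, n • of x ≠ of y)

include hE harch

theorem IsMV.exists_not_le_iff {a y : E} (ha : IsAtom a) {l : ℕ} (hl : 1 ≤ l)
    (hy : multiple l a = some y) : ∃ w, ∀ x, ¬ y ≤ x ↔ x ≤ EffectAlgebra.compl w := by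
  obtain ⟨_, w, -, -, hw⟩ := (isAtomIn_of_isAtom ha (mem_univ a)).exists_not_le_iff hE.isBlock_univ
    (harch a ha.1) hl ((nsmul_of l a).trans hy)
  exact ⟨w, fun x => hw x (mem_univ x)⟩

/-- The whole algebra is a block, so each generator's upper set is the complement of a closed lower
set; `u` needs only finitely many. -/
theorem IsMV.isClopen_Ici {u : E} (hu : u ∈ finJoins E) : @IsClopen E (intervalTop E) (Ici u) := by
  obtain ⟨S, hS, rfl⟩ := hu
  let := intervalTop E
  have : Ici (S.sup id) = ⋂ y ∈ S, Ici y := by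
    ext x
    simp
  rw [this]
  refine S.finite_toSet.isClopen_biInter fun y hy => ⟨isClosed_Ici_intervalTop y, ?_⟩
  obtain ⟨a, l, ha, hl, hla⟩ := hS y hy
  obtain ⟨w, hw⟩ := hE.exists_not_le_iff harch ha hl hla
  have : Ici y = (Iic (EffectAlgebra.compl w))ᶜ := by
    ext x
    simpa using (not_congr (hw x))
  rw [this]
  exact (isClosed_Iic_intervalTop _).isOpen_compl

theorem IsMV.isClopen_Iic {w : E} (hu : EffectAlgebra.compl w ∈ finJoins E) :
    @IsClopen E (intervalTop E) (Iic w) := by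
  obtain ⟨S, hS, hSw⟩ := hu
  let := intervalTop E
  have : Iic w = ⋂ y ∈ S, Iic (EffectAlgebra.compl y) := by
    ext x
    rw [mem_Iic, ← PartialSum.compl_compl w, hSw, le_compl_comm, Finset.sup_le_iff]
    simp [le_compl_comm (a := x)]
  rw [this]
  refine S.finite_toSet.isClopen_biInter fun y hy => ⟨isClosed_Iic_intervalTop _, ?_⟩
  obtain ⟨a, l, ha, hl, hla⟩ := hS y hy
  obtain ⟨v, hv⟩ := hE.exists_not_le_iff harch ha hl hla
  have : Iic (EffectAlgebra.compl y) = (Ici v)ᶜ := by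
    ext x
    have := hv (EffectAlgebra.compl x)
    rw [compl_le_comm, PartialSum.compl_compl] at this
    rw [mem_Iic, mem_compl_iff, mem_Ici, ← this, not_not, le_compl_comm]
  rw [this]
  exact (isClosed_Ici_intervalTop _).isOpen_compl

theorem IsMV.intervalTop_le_tauPhi : intervalTop E ≤ tauPhi E := by
  rw [tauPhi_eq_iInf]
  refine le_iInf fun ⟨φ, hφ⟩ => ?_
  let := intervalTop E
  rw [← continuous_iff_le_induced]
  rcases hφ with ⟨w, hw, rfl⟩ | ⟨w, hw, rfl⟩
  · exact (hE.isClopen_Ici harch hw).continuous_indicator continuous_const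
  · exact (hE.isClopen_Iic harch hw).continuous_indicator continuous_const

theorem IsMV.intervalTop_eq_orderTop (hat : IsAtomic E) : intervalTop E = orderTop E :=
  le_antisymm ((hE.intervalTop_le_tauPhi harch).trans (tauPhi_le_orderTop hat harch))
    orderTop_le_intervalTop

theorem IsMV.orderTop_eq_tauPhi (hat : IsAtomic E) : orderTop E = tauPhi E :=
  le_antisymm (orderTop_le_intervalTop.trans (hE.intervalTop_le_tauPhi harch))
    (tauPhi_le_orderTop hat harch)

theorem IsMV.t2Space_intervalTop (hat : IsAtomic E) : @T2Space E (intervalTop E) := by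
  let := intervalTop E
  have key (x y : E) (F : Ultrafilter E) (hx : ↑F ≤ 𝓝 x) (hy : ↑F ≤ 𝓝 y) : x ≤ y := by
    refine le_of_forall_finJoins_le hat harch fun u hu hux => ?_
    have hc := hE.isClopen_Ici harch hu
    exact mem_of_isClosed_of_le_nhds _ hc.1 hy (hx (hc.2.mem_nhds hux))
  exact t2_iff_ultrafilter.2 fun F hx hy => le_antisymm (key _ _ F hx hy) (key _ _ F hy hx)

theorem IsMV.tendsto_orderTop_iff (hat : IsAtomic E) (hc : IsCompleteLat E) {J : Type v}
    [Preorder J] [IsDirectedOrder J] [Nonempty J] {x : J → E} {a : E} :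
    Tendsto x atTop (@nhds E (orderTop E) a) ↔ OrderConverges x a := by
  have hio := hE.intervalTop_eq_orderTop harch hat
  -- Passing through `τ_i` allows index sets from any universe. Conversely, the bounding nets are
  -- the infima and suprema of the tails.
  refine ⟨fun h => ?_, fun h => hio ▸ h.tendsto_intervalTop⟩
  choose p hp using fun j => (hc (x '' Ici j)).2
  choose q hq using fun j => (hc (x '' Ici j)).1
  have hpx {i j : J} (h : j ≤ i) : p j ≤ x i := (hp j).1 ⟨i, h, rfl⟩
  have hxq {i j : J} (h : j ≤ i) : x i ≤ q j := (hq j).1 ⟨i, h, rfl⟩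
  rw [hE.orderTop_eq_tauPhi harch hat] at h
  have h' : Tendsto x atTop (@nhds E (intervalTop E) a) := by
    rwa [hio, hE.orderTop_eq_tauPhi harch hat]
  refine ⟨p, q, fun j => ⟨hpx le_rfl, hxq le_rfl⟩,
    fun i j hij => (hp j).2 ?_, ⟨?_, fun b hb => ?_⟩,
    fun i j hij => (hq j).2 ?_, ⟨?_, fun b hb => ?_⟩⟩
  · rintro _ ⟨k, hk, rfl⟩
    exact hpx (hij.trans hk)
  · rintro _ ⟨j, rfl⟩
    exact mem_of_isClosed_of_le_nhds _ (isClosed_Ici_intervalTop (p j)) h'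
      (mem_map.2 (mem_of_superset (Ici_mem_atTop j) fun i hi => hpx hi))
  · refine le_of_forall_finJoins_le hat harch fun u hu hua => ?_
    obtain ⟨j, hj⟩ := mem_atTop_sets.1
      (h (@IsOpen.mem_nhds E (tauPhi E) _ _ (isOpen_Ici_tauPhi hu) hua))
    refine le_trans ((hp j).2 ?_) (hb ⟨j, rfl⟩)
    rintro _ ⟨i, hi, rfl⟩
    exact hj i hi
  · rintro _ ⟨k, hk, rfl⟩
    exact hxq (hij.trans hk)
  · rintro _ ⟨j, rfl⟩
    exact mem_of_isClosed_of_le_nhds (s := Iic (q j)) _ (isClosed_Iic_intervalTop (q j)) h'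
      (mem_map.2 (mem_of_superset (Ici_mem_atTop j) fun i hi => hxq hi))
  · refine (isGLB_compl_finJoins hat harch a).2 fun w hw => ?_
    obtain ⟨j, hj⟩ := mem_atTop_sets.1
      (h (@IsOpen.mem_nhds E (tauPhi E) _ _ (isOpen_Iic_tauPhi hw.1) hw.2))
    refine le_trans (hb ⟨j, rfl⟩) ((hq j).2 ?_)
    rintro _ ⟨i, hi, rfl⟩
    exact hj i hi

end MV

/-! ### Complete atomic block-finite lattice effect algebras -/

section BlockFinite

theorem IsBlockFinite.exists_isLUB_isGLB (hE : IsBlockFinite E) (hat : IsAtomic E)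
    (hc : IsCompleteLat E) (F : Ultrafilter E) :
    ∃ (P Q : Set E) (m : E), (∀ p ∈ P, Ici p ∈ F) ∧ IsLUB P m ∧ (∀ q ∈ Q, Iic q ∈ F) ∧
      IsGLB Q m := by
  have hcover : ⋃₀ {B : Set E | IsBlock B} ∈ F := by
    refine mem_of_superset univ_mem fun x _ => ?_
    obtain ⟨B, hxB, hB⟩ := exists_isBlock_superset (S := {x}) (by
      rintro _ rfl _ rfl
      exact compatible_of_le le_rfl)
    exact ⟨B, hB, hxB rfl⟩
  obtain ⟨B, hB, hBF⟩ := (Ultrafilter.finite_sUnion_mem_iff hE).1 hcover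
  have hB : IsBlock B := hB
  obtain ⟨m, hm⟩ := (hc {p | p ∈ B ∧ Ici p ∈ F}).1
  obtain ⟨M, hM⟩ := (hc {q | q ∈ B ∧ Iic q ∈ F}).2
  have hmB : m ∈ B := hB.isLUB_mem (fun _ h => h.1) hm
  have hMB : M ∈ B := hB.isGLB_mem (fun _ h => h.1) hM
  have hmM : m ≤ M := by
    refine hm.2 fun p hp => hM.2 fun q hq => ?_
    obtain ⟨y, hpy, hyq⟩ := F.nonempty_of_mem (inter_mem hp.2 hq.2)
    exact le_trans hpy hyq
  suffices h : m = M from ⟨_, _, m, fun _ h => h.2, hm, fun _ h => h.2, h ▸ hM⟩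
  obtain ⟨b, hb⟩ := exists_add_eq hmM
  by_cases hb0 : b = 0
  · rw [hb0, of_zero, add_zero] at hb
    exact of_injective hb
  exfalso
  obtain ⟨a, ha, hab⟩ := hB.exists_isAtomIn_le hat hE (hB.sub_mem hmB hMB hb) hb0
  have harch := exists_nsmul_ne_of_isCompleteLat hc ha.2.1
  obtain ⟨N, hN⟩ := harch
  obtain ⟨Z, hZ⟩ := le_iff.1 hab
  -- If `F` contains the upper set of `ka`, then `ka ≤ m` and so `(k + 1)a ≤ M`. Were the upper set
  -- of `(k + 1)a` not in `F`, its complement within `B` would put some `Iic w'` in `F`, whence `(k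
  -- + 1)a ≤ M ≤ w'`, contrary to the choice of `w`.
  have key : ∀ k : ℕ, ∃ y, k • of a = of y ∧ Ici y ∈ F := by
    intro k
    induction k with
    | zero => exact ⟨0, zero_nsmul _, mem_of_superset univ_mem fun x _ => nonneg x⟩
    | succ k ih =>
      obtain ⟨y, hy, hyF⟩ := ih
      have hym : y ≤ m := hm.1 ⟨hB.nsmul_mem ha.1 k hy, hyF⟩
      obtain ⟨W, hW⟩ := le_iff.1 hym
      have h1 : (k + 1) • of a + (W + Z) = of M := by
        rw [← hb, ← hW, ← hZ, ← hy, succ_nsmul]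
        abel
      obtain ⟨t, ht⟩ := exists_of_of_add_eq h1
      have htM : t ≤ M := le_of_add_eq (ht ▸ h1)
      refine ⟨t, ht, ?_⟩
      obtain ⟨l, w, -, hw, hiff⟩ := ha.exists_not_le_iff hB ⟨N, hN⟩ (Nat.le_add_left 1 k) ht
      by_contra htF
      have hwB := hB.compl_mem (hB.nsmul_mem ha.1 l hw)
      have hwF : Iic (EffectAlgebra.compl w) ∈ F := by
        filter_upwards [Ultrafilter.compl_mem_iff_notMem.2 htF, hBF] with x hx hxB
        exact (hiff x hxB).1 hx
      exact (hiff _ hwB).2 le_rfl (htM.trans (hM.1 ⟨hwB, hwF⟩))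
  obtain ⟨y, hy, -⟩ := key N
  exact hN y hy

theorem IsBlockFinite.exists_le_nhds_orderTop (hE : IsBlockFinite E) (hat : IsAtomic E)
    (hc : IsCompleteLat E) (F : Ultrafilter E) :
    ∃ m, ↑F ≤ @nhds E (orderTop E) m ∧ ∀ z, ↑F ≤ @nhds E (intervalTop E) z → z = m := by
  obtain ⟨P, Q, m, hP, hPm, hQ, hQm⟩ := hE.exists_isLUB_isGLB hat hc F
  refine ⟨m, le_nhds_orderTop hP hPm hQ hQm, fun z hz => le_antisymm ?_ ?_⟩
  · exact hQm.2 fun q hq =>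
      mem_of_isClosed_of_le_nhds (s := Iic q) _ (isClosed_Iic_intervalTop q) hz (hQ q hq)
  · exact hPm.2 fun p hp => mem_of_isClosed_of_le_nhds _ (isClosed_Ici_intervalTop p) hz (hP p hp)

theorem IsBlockFinite.intervalTop_eq_orderTop (hE : IsBlockFinite E) (hat : IsAtomic E)
    (hc : IsCompleteLat E) : intervalTop E = orderTop E := by
  refine le_antisymm (le_of_nhds_le_nhds fun z => le_iff_ultrafilter.2 fun F hF => ?_)
    orderTop_le_intervalTop
  obtain ⟨m, hm, hz⟩ := hE.exists_le_nhds_orderTop hat hc F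
  rwa [hz z hF]

theorem IsBlockFinite.t2Space_intervalTop (hE : IsBlockFinite E) (hat : IsAtomic E)
    (hc : IsCompleteLat E) : @T2Space E (intervalTop E) := by
  refine (@t2_iff_ultrafilter E (intervalTop E)).2 fun F hx hy => ?_
  obtain ⟨m, -, hm⟩ := hE.exists_le_nhds_orderTop hat hc F
  rw [hm _ hx, hm _ hy]

end BlockFinite

end LatticeEffectAlgebra

theorem mainTheorem11 :
    (∀ (M : Type u) [LatticeEffectAlgebra M], IsMV M → IsArchimedean M → IsAtomic M →
      @T2Space M (intervalTop M) ∧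
      intervalTop M = orderTop M ∧ orderTop M = tauPhi M) ∧
    (∀ (M : Type u) [LatticeEffectAlgebra M], IsMV M → IsAtomic M → IsCompleteLat M →
      (∀ (J : Type v) [Preorder J] [IsDirectedOrder J] [Nonempty J] (x : J → M) (a : M),
        Filter.Tendsto x Filter.atTop (@nhds M (orderTop M) a) ↔ OrderConverges x a) ∧
      (∃ 𝒰 : UniformSpace M, 𝒰.toTopologicalSpace = orderTop M) ∧
      @CompactSpace M (orderTop M) ∧ @T2Space M (orderTop M)) ∧
    (∀ (E : Type u) [LatticeEffectAlgebra E], IsAtomic E → IsBlockFinite E →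
      (IsCompleteLat E ↔
        intervalTop E = orderTop E ∧
        @CompactSpace E (intervalTop E) ∧ @T2Space E (intervalTop E))) := by
  refine ⟨fun M _ hM harch hat => ?_, fun M _ hM hat hc => ?_, fun E _ hat hE => ⟨fun hc => ?_,
    fun h => isCompleteLat_of_compactSpace h.2.1⟩⟩
  · have harch' (x : M) (hx : x ≠ 0) := exists_nsmul_ne_of_isArchimedean harch hx
    exact ⟨hM.t2Space_intervalTop harch' hat, hM.intervalTop_eq_orderTop harch' hat,
      hM.orderTop_eq_tauPhi harch' hat⟩
  · have harch (x : M) (hx : x ≠ 0) := exists_nsmul_ne_of_isCompleteLat hc hx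
    refine ⟨fun J _ _ _ x a => hM.tendsto_orderTop_iff harch hat hc,
      ⟨uniformityPhi M, (hM.orderTop_eq_tauPhi harch hat).symm⟩, ?_⟩
    rw [← hM.intervalTop_eq_orderTop harch hat]
    exact ⟨hc.compactSpace_intervalTop, hM.t2Space_intervalTop harch hat⟩
  · exact ⟨hE.intervalTop_eq_orderTop hat hc, hc.compactSpace_intervalTop,
      hE.t2Space_intervalTop hat hc⟩
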